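/- Let $R_{\max}>0$, let $\mathcal A\subset\mathbb R^2$ be the disc of radius $R_{\max}$ centred at the origin, and let the base stations (BSs) form a homogeneous Poisson point process of density $\lambda_b>0$ on $\mathcal A$. A user is located at a point $u\in\mathcal A$ at distance $r$ from the origin, $0\le r\le R_{\max}$. Given the BS locations, the links from the user to the BSs are, independently of each other, non-line-of-sight (NLOS), a link of length $l$ with probability $$p_B(l)=1-e^{-\lambda\,(l-r_B)^+\,r_B},\qquad \lambda=\lambda_b+\lambda_u+\lambda_e,$$ where $\lambda_u,\lambda_e\ge 0$ are the densities of the users and of the external blockers and $r_B>0$ is the radius of the blockers. Let $r_0$ be the communication range, and assume $r_B<r_0$ and $r_B<R_{\max}$. For $R_{\max}-r<l<R_{\max}+r$ put $$\delta=\tfrac14\sqrt{(r+R_{\max}+l)(r+R_{\max}-l)(r-R_{\max}+l)(-r+R_{\max}+l)},$$ $$x_{1,2}=\pm\frac{2\delta}{r},\qquad y=\frac r2+\frac{R_{\max}^2-l^2}{2r},\qquad m_1=\frac{y-r}{x_1},\qquad m_2=\frac{y-r}{x_2},$$ $$\theta(l,r)=\pi+\arctan m_1-\arctan m_2,\qquad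 C(l,r)=\theta(l,r)\,l,$$ and put $C(l,r)=0$ for $l\ge R_{\max}+r$. Then, for every $l>R_{\max}-r$, $C(l,r)$ is the length of the part of the circle of radius $l$ around the user that lies in $\mathcal A$; moreover, for $R_{\max}-r<l<R_{\max}+r$, $\tan\theta(l,r)=\frac{m_1-m_2}{1+m_1m_2}$ whenever $1+m_1m_2\neq0$. The probability that there is at least one NLOS BS within distance $r_0$ of the user is $B_N>0$, where $$B_N=\begin{cases}1-\exp\Big(-2\pi\lambda_b\int_0^{r_0}v\,p_B(v)\,dv\Big), & r\le R_{\max}-r_0,\\[1ex] 1-\exp\Big(-\lambda_b\Big(2\pi\int_0^{R_{\max}-r}v\,p_B(v)\,dv+\int_{R_{\max}-r}^{r_0}C(v,r)\,p_B(v)\,dv\Big)\Big), & \text{otherwise.}\end{cases}$$ Conditionally on this event, the distance from the user to the nearest NLOS BS has on $[0,r_0]$ the (nonnegative) probability density $l\mapsto f_N(l,r)$ with respect to Lebesgue measure, where $$f_N(l,r)=\begin{cases}\dfrac{2\pi l\lambda_b\,p_B(l)}{B_N}\exp\Big(-2\pi\lambda_b\int_0^{l}v\,p_B(v)\,dv\Big),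 & r\le R_{\max}-r_0\ \text{or}\ l\le R_{\max}-r,\\[2ex] \dfrac{\lambda_b\,C(l,r)\,p_B(l)}{B_N}\exp\Big(-\lambda_b\Big(2\pi\int_0^{R_{\max}-r}v\,p_B(v)\,dv+\int_{R_{\max}-r}^{l}C(v,r)\,p_B(v)\,dv\Big)\Big), & \text{otherwise.}\end{cases}$$ -/

import Mathlib

open MeasureTheory ProbabilityTheory

noncomputable section

namespace MmWave

/-- The Euclidean plane. -/
abbrev Plane : Type := EuclideanSpace ℝ (Fin 2)

/-! ### Point processes with finitely many points -/

section PointProcess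

variable {Ω E : Type*} [MeasurableSpace Ω] [MeasurableSpace E]

/-- The number of points in `B` of the random finite configuration
`X 0 ω, …, X (K ω - 1) ω`. -/
def pointCount (K : Ω → ℕ) (X : ℕ → Ω → E) (B : Set E) (ω : Ω) : ℕ :=
  {i : ℕ | i < K ω ∧ X i ω ∈ B}.ncard

/-- The random finite configuration `X 0, …, X (K - 1)` is a Poisson point process with
(finite) intensity measure `Λ`: counts are Poisson distributed, and counts in pairwise disjoint
sets are independent. The values `X i ω` with `K ω ≤ i` play no role. -/
structure IsPoissonPointProcess (K : Ω → ℕ) (X : ℕ → Ω → E) (Λ : Measure E)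
    (P : Measure Ω) : Prop where
  measurable_num : Measurable K
  measurable_point : ∀ i, Measurable (X i)
  count_law : ∀ B : Set E, MeasurableSet B →
    HasLaw (pointCount K X B) (poissonMeasure (Λ B).toNNReal) P
  count_indep : ∀ (n : ℕ) (B : Fin n → Set E), (∀ j, MeasurableSet (B j)) →
    Pairwise (fun j k => Disjoint (B j) (B k)) →
    iIndepFun (fun j => pointCount K X (B j)) P

/-- The σ-algebra generated by the configuration. -/
abbrev configSigma (K : Ω → ℕ) (X : ℕ → Ω → E) : MeasurableSpace Ω :=
  MeasurableSpace.comap (fun ω => (K ω, fun i => X i ω)) inferInstance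

/-- The events `Z i` ("the `i`-th point is marked") form an independent marking of the
configuration with location dependent probability `p`: conditionally on the
configuration, the points are marked independently of each other, a point at `x` with
probability `p x`. Only the marks of the actual points, `i < K`, matter. -/
structure IsIndependentMarking (K : Ω → ℕ) (X : ℕ → Ω → E) (Z : ℕ → Set Ω) (p : E → ℝ)
    (P : Measure Ω) : Prop where
  measurableSet_mark : ∀ i, MeasurableSet (Z i)
  condExp_marks : ∀ S : Finset ℕ,
    P[(⋂ i ∈ S, ({ω | i < K ω} ∩ Z i)).indicator (fun _ => (1 : ℝ)) | configSigma K X]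
      =ᵐ[P] fun ω => ∏ i ∈ S, if i < K ω then p (X i ω) else 0

end PointProcess

/-! ### Nearest marked (NLOS) base station -/

section Nearest

variable {Ω : Type*}

/-- The event that some marked point lies within distance `r₀` of `u`. -/
def markedInRange (K : Ω → ℕ) (X : ℕ → Ω → Plane) (Z : ℕ → Set Ω) (u : Plane) (r₀ : ℝ) :
    Set Ω :=
  {ω | ∃ i, i < K ω ∧ ω ∈ Z i ∧ dist (X i ω) u ≤ r₀}

/-- The distance from `u` to the nearest marked point (only used on the event that there is a
marked point). -/
def nearestMarkedDist (K : Ω → ℕ) (X : ℕ → Ω → Plane) (Z : ℕ → Set Ω) (u : Plane) (ω : Ω) : ℝ :=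
  sInf {d : ℝ | ∃ i, i < K ω ∧ ω ∈ Z i ∧ d = dist (X i ω) u}

end Nearest

/-! ### Blockage probability -/

/-- Blockage probability `1 - exp (-lam (l - rB) rB)` of a link of length `l`, where `lam` is the
total density of blockers; a link shorter than the blocker radius `rB` is not blocked. -/
def pB (lam rB l : ℝ) : ℝ := 1 - Real.exp (-lam * max (l - rB) 0 * rB)

/-! ### Geometry: the circle of radius `l` around a user at distance `r` from the centre of the
disc of radius `R`. The user sits at `(0, r)`; `(x₁, y), (x₂, y)` are the points where the two
circles meet and `m₁, m₂` the slopes of the lines joining them to the user. -/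

def heronArea (R l r : ℝ) : ℝ :=
  Real.sqrt ((r + R + l) * (r + R - l) * (r - R + l) * (-r + R + l)) / 4

def x₁ (R l r : ℝ) : ℝ := 2 * heronArea R l r / r

def x₂ (R l r : ℝ) : ℝ := -(2 * heronArea R l r / r)

def yInter (R l r : ℝ) : ℝ := r / 2 + (R ^ 2 - l ^ 2) / (2 * r)

def m₁ (R l r : ℝ) : ℝ := (yInter R l r - r) / x₁ R l r

def m₂ (R l r : ℝ) : ℝ := (yInter R l r - r) / x₂ R l r

/-- The angle under which the user sees the part of its circle of radius `l > R - r` that lies in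
the disc: the branch `π + arctan m₁ - arctan m₂` of `tan⁻¹ ((m₁ - m₂) / (1 + m₁ m₂))`, and `0` once
the circle surrounds the disc. -/
def arcAngle (R l r : ℝ) : ℝ :=
  if l < R + r then Real.pi + Real.arctan (m₁ R l r) - Real.arctan (m₂ R l r) else 0

/-- `C(l, r) = θ(l, r) l`. -/
def arcC (R l r : ℝ) : ℝ := arcAngle R l r * l

/-- The length of the part of the circle of centre `u` and radius `l` that lies in the disc of
radius `R` around the origin. -/
def circleLengthInDisc (R l : ℝ) (u : Plane) : ℝ :=
  l * (volume {φ : ℝ | φ ∈ Set.Ioc (-Real.pi) Real.pi ∧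
    u + l • (!₂[Real.cos φ, Real.sin φ] : Plane) ∈ Metric.closedBall (0 : Plane) R}).toReal

/-! ### The closed formulas -/

/-- The probability `B_N`, for base station density `lb` and blockage probability `p`. -/
def BN (lb R r₀ : ℝ) (p : ℝ → ℝ) (r : ℝ) : ℝ :=
  if r ≤ R - r₀ then
    1 - Real.exp (-(2 * Real.pi * lb * ∫ v in (0 : ℝ)..r₀, v * p v))
  else
    1 - Real.exp (-(lb * (2 * Real.pi * (∫ v in (0 : ℝ)..(R - r), v * p v)
      + ∫ v in (R - r)..r₀, arcC R v r * p v)))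

/-- The density `f_N(l, r)`. -/
def fN (lb R r₀ : ℝ) (p : ℝ → ℝ) (l r : ℝ) : ℝ :=
  if r ≤ R - r₀ ∨ l ≤ R - r then
    2 * Real.pi * l * lb * p l *
      Real.exp (-(2 * Real.pi * lb * ∫ v in (0 : ℝ)..l, v * p v)) / BN lb R r₀ p r
  else
    lb * arcC R l r * p l *
      Real.exp (-(lb * (2 * Real.pi * (∫ v in (0 : ℝ)..(R - r), v * p v)
        + ∫ v in (R - r)..l, arcC R v r * p v))) / BN lb R r₀ p r

end MmWave

end

/-!
The nearest NLOS base station is farther away than `t` exactly when no marked point lies in the ball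
of radius `t` around the user, so everything rests on the void probabilities
`exp (-∫ x in B, p x ∂Λ)` of the marked process. Conditioning on the configuration replaces each
mark by its probability, so the void probability is `𝔼 ∏ (1 - p (X i))` over the points `X i ∈ B`,
a value of the probability generating functional `𝔼 ∏ g (X i) = exp (∫ (g - 1) ∂Λ)` of the Poisson
process; for simple `g` the latter reduces to the independent Poisson counts on the fibres of `g`.
In polar coordinates around the user the exponent is `∫ v in 0..t, lb * C(v) * p v`, the cumulative
hazard of the distance to the nearest marked point, and differentiating `1 - exp` of it gives the
density. The law of cosines identifies `C(v)` with the formula in `arctan`.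
-/

namespace MmWave

section PointProcess

variable {Ω E : Type*}

/-- The event that some marked point lies in `B`; `markedInRange` is the case of a closed ball. -/
def markedIn (K : Ω → ℕ) (X : ℕ → Ω → E) (Z : ℕ → Set Ω) (B : Set E) : Set Ω :=
  {ω | ∃ i, i < K ω ∧ ω ∈ Z i ∧ X i ω ∈ B}

lemma indicator_markedIn_compl (K : Ω → ℕ) (X : ℕ → Ω → E) (Z : ℕ → Set Ω) (B : Set E) (ω : Ω) :
    (markedIn K X Z B)ᶜ.indicator (1 : Ω → ℝ) ω
      = ∏ i ∈ Finset.range (K ω), (1 - (Z i).indicator (fun ω => B.indicator 1 (X i ω)) ω) := by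
  by_cases hω : ω ∈ markedIn K X Z B
  · obtain ⟨i, hi, hz, hB⟩ := id hω
    rw [Set.indicator_of_notMem (not_not.2 hω)]
    refine (Finset.prod_eq_zero (Finset.mem_range.2 hi) ?_).symm
    rw [Set.indicator_of_mem hz, Set.indicator_of_mem hB, Pi.one_apply, sub_self]
  · rw [Set.indicator_of_mem hω, Pi.one_apply, Finset.prod_eq_one]
    intro i hi
    rw [Set.indicator_apply_eq_zero.2, sub_zero]
    exact fun hz => Set.indicator_of_notMem
      (fun hB => hω ⟨i, Finset.mem_range.1 hi, hz, hB⟩) _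

variable [MeasurableSpace E]

lemma prod_range_simpleFunc (K : Ω → ℕ) (X : ℕ → Ω → E) (g : SimpleFunc E ℝ) (ω : Ω) :
    ∏ i ∈ Finset.range (K ω), g (X i ω)
      = ∏ c : g.range, (c : ℝ) ^ pointCount K X (g ⁻¹' {(c : ℝ)}) ω := by
  have hcount : ∀ c, pointCount K X (g ⁻¹' {c}) ω
      = ((Finset.range (K ω)).filter fun i => g (X i ω) = c).card := fun c => by
    rw [pointCount, ← Set.ncard_coe_finset]
    congr 1
    ext i
    simp
  rw [Finset.prod_coe_sort g.range fun c => c ^ pointCount K X (g ⁻¹' {c}) ω,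
    ← Finset.prod_fiberwise_of_maps_to fun i _ => g.mem_range_self (X i ω)]
  refine Finset.prod_congr rfl fun c _ => ?_
  rw [hcount]
  exact Finset.prod_eq_pow_card fun i hi => (Finset.mem_filter.1 hi).2

lemma measurable_configSigma_point (K : Ω → ℕ) (X : ℕ → Ω → E) (i : ℕ) :
    Measurable[configSigma K X] (X i) :=
  ((measurable_pi_apply i).comp measurable_snd).comp
    (comap_measurable fun ω => (K ω, fun i => X i ω))

variable [MeasurableSpace Ω] {K : Ω → ℕ} {X : ℕ → Ω → E} {P : Measure Ω}

lemma integral_pow_poissonMeasure (a : NNReal) (c : ℝ) :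
    ∫ n, c ^ n ∂(poissonMeasure a) = Real.exp (a * (c - 1)) := by
  have hsum := (NormedSpace.expSeries_div_hasSum_exp ((a : ℝ) * c)).mul_left (Real.exp (-a))
  rw [← Real.exp_eq_exp_ℝ, ← Real.exp_add] at hsum
  rw [integral_poissonMeasure, show (a : ℝ) * (c - 1) = -a + a * c by ring, ← hsum.tsum_eq]
  refine tsum_congr fun n => ?_
  rw [smul_eq_mul, mul_pow]
  ring

lemma integral_simpleFunc_sub_one {Λ : Measure E} [IsFiniteMeasure Λ] (g : SimpleFunc E ℝ) :
    ∫ x, (g x - 1) ∂Λ = ∑ c ∈ g.range, Λ.real (g ⁻¹' {c}) * (c - 1) := by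
  have hg : Integrable g Λ := SimpleFunc.integrable_of_isFiniteMeasure g
  have hmass : ∑ c ∈ g.range, Λ.real (g ⁻¹' {c}) = Λ.real Set.univ := by
    rw [measureReal_def, ← g.sum_range_measure_preimage_singleton Λ,
      ENNReal.toReal_sum fun _ _ => measure_ne_top _ _]
    rfl
  simp only [integral_sub hg (integrable_const 1), SimpleFunc.integral_eq_sum g hg, integral_const,
    smul_eq_mul, mul_one, mul_sub, Finset.sum_sub_distrib, hmass]

lemma norm_prod_le_one {ι : Type*} (s : Finset ι) {f : ι → ℝ} (hf : ∀ i, ‖f i‖ ≤ 1) :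
    ‖∏ i ∈ s, f i‖ ≤ 1 := by
  rw [norm_prod]
  exact Finset.prod_le_one (fun _ _ => norm_nonneg _) fun i _ => hf i

lemma integrable_prod_of_norm_le_one [IsFiniteMeasure P] {ι : Type*} (s : Finset ι)
    {h : ι → Ω → ℝ} (hm : ∀ i, Measurable (h i)) (h1 : ∀ i ω, ‖h i ω‖ ≤ 1) :
    Integrable (fun ω => ∏ i ∈ s, h i ω) P :=
  .of_bound (Finset.measurable_fun_prod s fun i _ => hm i).aestronglyMeasurable 1
    (.of_forall fun ω => norm_prod_le_one s fun i => h1 i ω)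

lemma measurable_prod_range (hK : Measurable K) {f : ℕ → Ω → ℝ} (hf : ∀ i, Measurable (f i)) :
    Measurable fun ω => ∏ i ∈ Finset.range (K ω), f i ω := by
  have hprod : Measurable fun q : ℕ × Ω => ∏ i ∈ Finset.range q.1, f i q.2 :=
    measurable_from_prod_countable_right fun n =>
      Finset.measurable_fun_prod (Finset.range n) fun i _ => hf i
  exact hprod.comp (hK.prodMk measurable_id)

namespace IsPoissonPointProcess

variable {Λ : Measure E}

lemma iIndepFun_pointCount (hX : IsPoissonPointProcess K X Λ P) {ι : Type*} [Finite ι]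
    {B : ι → Set E} (hB : ∀ i, MeasurableSet (B i))
    (hdisj : Pairwise fun i j => Disjoint (B i) (B j)) :
    iIndepFun (fun i => pointCount K X (B i)) P := by
  have e := Finite.equivFin ι
  have hindep := (hX.count_indep _ (fun j => B (e.symm j)) (fun j => hB _)
    fun j k hjk => hdisj (e.symm.injective.ne hjk)).precomp e.injective
  simpa only [Equiv.symm_apply_apply] using hindep

lemma integral_pow_pointCount (hX : IsPoissonPointProcess K X Λ P) {B : Set E}
    (hB : MeasurableSet B) (c : ℝ) :
    ∫ ω, c ^ pointCount K X B ω ∂P = Real.exp (Λ.real B * (c - 1)) :=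
  ((hX.count_law B hB).integral_comp (f := fun n => c ^ n)
    (measurable_of_countable _).aestronglyMeasurable).trans (integral_pow_poissonMeasure _ c)

lemma integral_prod_simpleFunc [IsFiniteMeasure Λ] (hX : IsPoissonPointProcess K X Λ P)
    (g : SimpleFunc E ℝ) :
    ∫ ω, ∏ i ∈ Finset.range (K ω), g (X i ω) ∂P = Real.exp (∫ x, (g x - 1) ∂Λ) := by
  have hfibre : ∀ c, MeasurableSet (g ⁻¹' {c}) := fun c => g.measurableSet_preimage {c}
  have hindep : iIndepFun (fun c : g.range => pointCount K X (g ⁻¹' {(c : ℝ)})) P :=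
    hX.iIndepFun_pointCount (fun c => hfibre c) fun c d hcd =>
      Disjoint.preimage _ (Set.disjoint_singleton.2 (Subtype.coe_injective.ne hcd))
  simp_rw [prod_range_simpleFunc]
  rw [hindep.integral_fun_prod_comp (f := fun (c : g.range) (n : ℕ) => (c : ℝ) ^ n)
    (fun c => (hX.count_law _ (hfibre c)).aemeasurable)
    (fun c => (measurable_of_countable _).aestronglyMeasurable)]
  simp_rw [hX.integral_pow_pointCount (hfibre _)]
  rw [← Real.exp_sum, integral_simpleFunc_sub_one,
    Finset.sum_coe_sort g.range fun c => Λ.real (g ⁻¹' {c}) * (c - 1)]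

theorem integral_prod [IsFiniteMeasure Λ] [IsFiniteMeasure P] (hX : IsPoissonPointProcess K X Λ P)
    {g : E → ℝ} (hg : Measurable g) (hg1 : ∀ x, ‖g x‖ ≤ 1) :
    ∫ ω, ∏ i ∈ Finset.range (K ω), g (X i ω) ∂P = Real.exp (∫ x, (g x - 1) ∂Λ) := by
  let s : ℕ → SimpleFunc E ℝ := hg.stronglyMeasurable.approxBounded 1
  have hs1 : ∀ n x, ‖s n x‖ ≤ 1 := hg.stronglyMeasurable.norm_approxBounded_le zero_le_one
  have hs : ∀ x, Filter.Tendsto (fun n => s n x) Filter.atTop (nhds (g x)) :=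
    fun x => hg.stronglyMeasurable.tendsto_approxBounded_of_norm_le (hg1 x)
  have hleft : Filter.Tendsto (fun n => ∫ ω, ∏ i ∈ Finset.range (K ω), s n (X i ω) ∂P) Filter.atTop
      (nhds (∫ ω, ∏ i ∈ Finset.range (K ω), g (X i ω) ∂P)) := by
    refine tendsto_integral_of_dominated_convergence (fun _ => 1) (fun n => ?_)
      (integrable_const 1) (fun n => .of_forall fun ω => ?_)
      (.of_forall fun ω => tendsto_finsetProd _ fun i _ => hs _)
    · exact (measurable_prod_range hX.measurable_num fun i =>
        (s n).measurable.comp (hX.measurable_point i)).aestronglyMeasurable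
    · exact norm_prod_le_one _ fun i => hs1 n _
  have hright : Filter.Tendsto (fun n => ∫ x, (s n x - 1) ∂Λ) Filter.atTop
      (nhds (∫ x, (g x - 1) ∂Λ)) := by
    refine tendsto_integral_of_dominated_convergence (fun _ => 1 + 1)
      (fun n => ((s n).measurable.sub_const 1).aestronglyMeasurable)
      (integrable_const _) (fun n => .of_forall fun x => ?_)
      (.of_forall fun x => (hs x).sub_const 1)
    exact (norm_sub_le _ _).trans (add_le_add (hs1 n x) norm_one.le)
  simp_rw [hX.integral_prod_simpleFunc] at hleft
  exact tendsto_nhds_unique hleft ((Real.continuous_exp.tendsto _).comp hright)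

end IsPoissonPointProcess

lemma configSigma_le (hK : Measurable K) (hX : ∀ i, Measurable (X i)) :
    configSigma K X ≤ ‹MeasurableSpace Ω› :=
  (hK.prodMk (measurable_pi_lambda _ hX)).comap_le

lemma tendsto_integral_prod_range [IsFiniteMeasure P] {h : ℕ → Ω → ℝ} (hm : ∀ i, Measurable (h i))
    (h1 : ∀ i ω, ‖h i ω‖ ≤ 1) (hK : ∀ i ω, K ω ≤ i → h i ω = 1) :
    Filter.Tendsto (fun n => ∫ ω, ∏ i ∈ Finset.range n, h i ω ∂P) Filter.atTop
      (nhds (∫ ω, ∏ i ∈ Finset.range (K ω), h i ω ∂P)) := by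
  refine tendsto_integral_of_dominated_convergence (fun _ => 1)
    (fun n => (Finset.measurable_fun_prod _ fun i _ => hm i).aestronglyMeasurable)
    (integrable_const 1) (fun n => .of_forall fun ω => ?_) (.of_forall fun ω => ?_)
  · exact norm_prod_le_one _ fun i => h1 i ω
  · refine tendsto_const_nhds.congr' (Filter.eventually_atTop.2 ⟨K ω, fun n hn => ?_⟩)
    refine Finset.prod_subset (Finset.range_mono hn) fun i _ hi => hK i ω ?_
    simpa only [Finset.mem_range, not_lt] using hi

namespace IsIndependentMarking

variable {Z : ℕ → Set Ω} {p : E → ℝ} [IsFiniteMeasure P]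

lemma integral_prod_indicator (hZ : IsIndependentMarking K X Z p P) (hK : Measurable K)
    (hX : ∀ i, Measurable (X i)) {f : E → ℝ} (hf : Measurable f) (hf1 : ∀ x, ‖f x‖ ≤ 1)
    (S : Finset ℕ) :
    ∫ ω, ∏ i ∈ S, ({ω | i < K ω} ∩ Z i).indicator (fun ω => f (X i ω)) ω ∂P
      = ∫ ω, ∏ i ∈ S, (if i < K ω then p (X i ω) else 0) * f (X i ω) ∂P := by
  let W : Ω → ℝ := fun ω => ∏ i ∈ S, f (X i ω)
  let M : Set Ω := ⋂ i ∈ S, ({ω | i < K ω} ∩ Z i)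
  have hW : StronglyMeasurable[configSigma K X] W :=
    (Finset.measurable_fun_prod S fun i _ =>
      hf.comp (measurable_configSigma_point K X i)).stronglyMeasurable
  have hW1 : ∀ ω, ‖W ω‖ ≤ 1 := fun ω => norm_prod_le_one S fun i => hf1 _
  have hM : Integrable (M.indicator fun _ => (1 : ℝ)) P :=
    (integrable_const 1).indicator (Finset.measurableSet_biInter _ fun i _ =>
      (measurableSet_lt measurable_const hK).inter (hZ.measurableSet_mark i))
  have hsplit : ∀ ω, ∏ i ∈ S, ({ω | i < K ω} ∩ Z i).indicator (fun ω => f (X i ω)) ω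
      = W ω * M.indicator (fun _ => 1) ω := fun ω => by
    by_cases hω : ω ∈ M
    · rw [Set.indicator_of_mem hω, mul_one]
      exact Finset.prod_congr rfl fun i hi => Set.indicator_of_mem (Set.mem_iInter₂.1 hω i hi) _
    · obtain ⟨i, hi, hiω⟩ : ∃ i, ∃ _ : i ∈ S, ω ∉ {ω | i < K ω} ∩ Z i := by
        simpa only [M, Set.mem_iInter, not_forall] using hω
      rw [Set.indicator_of_notMem hω, mul_zero]
      exact Finset.prod_eq_zero hi (Set.indicator_of_notMem hiω _)
  have hcond := condExp_stronglyMeasurable_mul_of_bound (configSigma_le hK hX) hW hM 1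
    (.of_forall hW1)
  simp_rw [hsplit]
  calc ∫ ω, W ω * M.indicator (fun _ => 1) ω ∂P
      = ∫ ω, (P[W * M.indicator (fun _ => 1) | configSigma K X]) ω ∂P :=
        (integral_condExp (configSigma_le hK hX)).symm
    _ = ∫ ω, ∏ i ∈ S, (if i < K ω then p (X i ω) else 0) * f (X i ω) ∂P := by
        refine integral_congr_ae ?_
        filter_upwards [hcond, hZ.condExp_marks S] with ω hω hmarks
        rw [hω, Pi.mul_apply, hmarks, mul_comm, Finset.prod_mul_distrib]

-- `IsIndependentMarking` only controls joint marks, so the product is expanded over subsets of `S`.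
lemma integral_prod_one_sub (hZ : IsIndependentMarking K X Z p P) (hK : Measurable K)
    (hX : ∀ i, Measurable (X i)) (hp : Measurable p) (hp1 : ∀ x, ‖p x‖ ≤ 1)
    {f : E → ℝ} (hf : Measurable f) (hf1 : ∀ x, ‖f x‖ ≤ 1) (S : Finset ℕ) :
    ∫ ω, ∏ i ∈ S, (1 - ({ω | i < K ω} ∩ Z i).indicator (fun ω => f (X i ω)) ω) ∂P
      = ∫ ω, ∏ i ∈ S, (1 - (if i < K ω then p (X i ω) else 0) * f (X i ω)) ∂P := by
  have hlt : ∀ i, MeasurableSet {ω | i < K ω} := fun i => measurableSet_lt measurable_const hK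
  have hmark : ∀ T : Finset ℕ, Integrable
      (fun ω => ∏ i ∈ T, ({ω | i < K ω} ∩ Z i).indicator (fun ω => f (X i ω)) ω) P := fun T =>
    integrable_prod_of_norm_le_one T
      (fun i => (hf.comp (hX i)).indicator ((hlt i).inter (hZ.measurableSet_mark i)))
      fun i ω => (norm_indicator_le_norm_self _ _).trans (hf1 _)
  have hprob : ∀ T : Finset ℕ, Integrable
      (fun ω => ∏ i ∈ T, (if i < K ω then p (X i ω) else 0) * f (X i ω)) P := fun T => by
    refine integrable_prod_of_norm_le_one T
      (fun i => (Measurable.ite (hlt i) (hp.comp (hX i)) measurable_const).mul (hf.comp (hX i)))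
      fun i ω => ?_
    rw [norm_mul]
    refine mul_le_one₀ ?_ (norm_nonneg _) (hf1 _)
    split_ifs
    · exact hp1 _
    · exact norm_zero.trans_le zero_le_one
  simp_rw [sub_eq_add_neg, Finset.prod_one_add, Finset.prod_neg]
  rw [integral_finsetSum _ fun T _ => (hmark T).const_mul _,
    integral_finsetSum _ fun T _ => (hprob T).const_mul _]
  simp_rw [integral_const_mul, hZ.integral_prod_indicator hK hX hf hf1]

-- Marks are controlled on fixed finite index sets only, while `K` is random: the factors with
-- `K ω ≤ i` are made equal to `1` and `Finset.range (K ω)` is replaced by `Finset.range n`,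
-- `n → ∞`.
theorem integral_prod_range (hZ : IsIndependentMarking K X Z p P) (hK : Measurable K)
    (hX : ∀ i, Measurable (X i)) (hp : Measurable p) (hp01 : ∀ x, p x ∈ Set.Icc (0 : ℝ) 1)
    {f : E → ℝ} (hf : Measurable f) (hf01 : ∀ x, f x ∈ Set.Icc (0 : ℝ) 1) :
    ∫ ω, ∏ i ∈ Finset.range (K ω), (1 - (Z i).indicator (fun ω => f (X i ω)) ω) ∂P
      = ∫ ω, ∏ i ∈ Finset.range (K ω), (1 - p (X i ω) * f (X i ω)) ∂P := by
  have hlt : ∀ i, MeasurableSet {ω | i < K ω} := fun i => measurableSet_lt measurable_const hK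
  have hnorm : ∀ {a : ℝ}, a ∈ Set.Icc (0 : ℝ) 1 → ‖a‖ ≤ 1 := fun ha =>
    (Real.norm_of_nonneg ha.1).trans_le ha.2
  have hmark := tendsto_integral_prod_range (P := P) (K := K)
    (h := fun i ω => 1 - ({ω | i < K ω} ∩ Z i).indicator (fun ω => f (X i ω)) ω)
    (fun i => ((hf.comp (hX i)).indicator ((hlt i).inter (hZ.measurableSet_mark i))).const_sub 1)
    (fun i ω => hnorm <| Set.Icc.one_sub_mem ⟨Set.indicator_nonneg (fun _ _ => (hf01 _).1) ω,
      Set.indicator_apply_le' (fun _ => (hf01 _).2) fun _ => zero_le_one⟩)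
    (fun i ω hi => by
      rw [Set.indicator_of_notMem fun hω => hi.not_gt hω.1, sub_zero])
  have hprob := tendsto_integral_prod_range (P := P) (K := K)
    (h := fun i ω => 1 - (if i < K ω then p (X i ω) else 0) * f (X i ω))
    (fun i => ((Measurable.ite (hlt i) (hp.comp (hX i)) measurable_const).mul
      (hf.comp (hX i))).const_sub 1)
    (fun i ω => hnorm <| Set.Icc.one_sub_mem <| unitInterval.mul_mem (by
      split_ifs
      exacts [hp01 _, unitInterval.zero_mem]) (hf01 _))
    (fun i ω hi => by rw [if_neg hi.not_gt, zero_mul, sub_zero])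
  simp_rw [hZ.integral_prod_one_sub hK hX hp (fun x => hnorm (hp01 x)) hf
    fun x => hnorm (hf01 x)] at hmark
  refine Eq.trans (integral_congr_ae (.of_forall fun ω => Finset.prod_congr rfl fun i hi => ?_))
    ((tendsto_nhds_unique hmark hprob).trans
      (integral_congr_ae (.of_forall fun ω => Finset.prod_congr rfl fun i hi => ?_)))
  · rw [← Set.indicator_indicator,
      Set.indicator_of_mem (s := {ω | i < K ω}) (Finset.mem_range.1 hi)]
  · rw [if_pos (Finset.mem_range.1 hi)]

end IsIndependentMarking

variable {Z : ℕ → Set Ω} {p : E → ℝ} {B : Set E}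

lemma measurableSet_markedIn (hK : Measurable K) (hX : ∀ i, Measurable (X i))
    (hZ : ∀ i, MeasurableSet (Z i)) (hB : MeasurableSet B) :
    MeasurableSet (markedIn K X Z B) := by
  have hunion : markedIn K X Z B = ⋃ i, {ω | i < K ω} ∩ (Z i ∩ X i ⁻¹' B) := by
    ext ω
    simp only [markedIn, Set.mem_ofPred_eq, Set.mem_iUnion, Set.mem_inter_iff, Set.mem_preimage]
  rw [hunion]
  exact .iUnion fun i => (measurableSet_lt measurable_const hK).inter ((hZ i).inter (hX i hB))

theorem IsPoissonPointProcess.measureReal_markedIn_compl {Λ : Measure E} [IsFiniteMeasure Λ]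
    [IsFiniteMeasure P] (hX : IsPoissonPointProcess K X Λ P)
    (hZ : IsIndependentMarking K X Z p P) (hp : Measurable p)
    (hp01 : ∀ x, p x ∈ Set.Icc (0 : ℝ) 1) (hB : MeasurableSet B) :
    P.real (markedIn K X Z B)ᶜ = Real.exp (-∫ x in B, p x ∂Λ) := by
  have hB01 : ∀ x, B.indicator (1 : E → ℝ) x ∈ Set.Icc (0 : ℝ) 1 := fun x =>
    ⟨Set.indicator_nonneg (fun _ _ => zero_le_one) x,
      Set.indicator_apply_le' (fun _ => le_rfl) fun _ => zero_le_one⟩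
  have hthin : ∀ x, 1 - p x * B.indicator 1 x ∈ Set.Icc (0 : ℝ) 1 := fun x =>
    Set.Icc.one_sub_mem (unitInterval.mul_mem (hp01 x) (hB01 x))
  rw [← integral_indicator_one (measurableSet_markedIn hX.measurable_num hX.measurable_point
    hZ.measurableSet_mark hB).compl]
  simp_rw [indicator_markedIn_compl]
  rw [hZ.integral_prod_range hX.measurable_num hX.measurable_point hp hp01
      (measurable_one.indicator hB) hB01,
    hX.integral_prod (g := fun x => 1 - p x * B.indicator 1 x)
      ((hp.mul (measurable_one.indicator hB)).const_sub 1)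
      fun x => (Real.norm_of_nonneg (hthin x).1).trans_le (hthin x).2,
    ← integral_indicator hB, ← integral_neg]
  congr 2 with x
  rw [sub_sub_cancel_left, ← Set.indicator_mul_right]
  simp only [Pi.one_apply, mul_one]

end PointProcess

section Geometry

/-- The point of the circle of centre `u` and radius `l` seen from `u` in direction `φ`. -/
noncomputable def circlePoint (u : Plane) (l φ : ℝ) : Plane :=
  u + l • (!₂[Real.cos φ, Real.sin φ] : Plane)

lemma dist_circlePoint (u : Plane) (l φ : ℝ) : dist (circlePoint u l φ) u = |l| := by
  rw [circlePoint, dist_self_add_left, norm_smul, EuclideanSpace.norm_eq, Fin.sum_univ_two]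
  simp

lemma continuous_circlePoint (u : Plane) : Continuous fun q : ℝ × ℝ => circlePoint u q.1 q.2 := by
  have hdir : Continuous fun φ : ℝ => (!₂[Real.cos φ, Real.sin φ] : Plane) :=
    (PiLp.continuous_toLp 2 _).comp (by fun_prop)
  exact continuous_const.add (continuous_fst.smul (hdir.comp continuous_snd))

lemma circleLengthInDisc_eq (R l : ℝ) (u : Plane) : circleLengthInDisc R l u =
    l * volume.real (Set.Ioc (-Real.pi) Real.pi ∩ circlePoint u l ⁻¹' Metric.closedBall 0 R) :=
  rfl

lemma measurable_circleLengthInDisc (R : ℝ) (u : Plane) :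
    Measurable fun l => circleLengthInDisc R l u := by
  have hinDisc : MeasurableSet {q : ℝ × ℝ | circlePoint u q.1 q.2 ∈ Metric.closedBall 0 R} :=
    (Metric.isClosed_closedBall.preimage (continuous_circlePoint u)).measurableSet
  exact measurable_id.mul (measurable_measure_prodMk_left
    ((measurable_snd measurableSet_Ioc).inter hinDisc)).ennreal_toReal

lemma norm_circleLengthInDisc_le (R l : ℝ) (u : Plane) :
    ‖circleLengthInDisc R l u‖ ≤ 2 * Real.pi * ‖l‖ := by
  rw [circleLengthInDisc_eq, norm_mul, mul_comm]
  gcongr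
  rw [Real.norm_of_nonneg measureReal_nonneg]
  refine (measureReal_mono Set.inter_subset_left (by simp)).trans_eq ?_
  rw [Real.volume_real_Ioc_of_le (by linarith [Real.pi_pos])]
  ring

lemma circleLengthInDisc_nonneg {l : ℝ} (hl : 0 ≤ l) (R : ℝ) (u : Plane) :
    0 ≤ circleLengthInDisc R l u :=
  mul_nonneg hl measureReal_nonneg

lemma circleLengthInDisc_of_le {R l : ℝ} {u : Plane} (hl0 : 0 ≤ l) (hl : l ≤ R - ‖u‖) :
    circleLengthInDisc R l u = 2 * Real.pi * l := by
  have hall : circlePoint u l ⁻¹' Metric.closedBall 0 R = Set.univ := by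
    refine Set.eq_univ_of_forall fun φ => ?_
    have hdist := dist_circlePoint u l φ
    rw [Set.mem_preimage, mem_closedBall_zero_iff]
    rw [abs_of_nonneg hl0, dist_eq_norm] at hdist
    linarith [norm_le_norm_add_norm_sub' (circlePoint u l φ) u]
  rw [circleLengthInDisc_eq, hall, Set.inter_univ,
    Real.volume_real_Ioc_of_le (by linarith [Real.pi_pos])]
  ring

lemma circleLengthInDisc_of_gt {R l : ℝ} {u : Plane} (hl0 : 0 ≤ l) (hl : R + ‖u‖ < l) :
    circleLengthInDisc R l u = 0 := by
  have hnone : circlePoint u l ⁻¹' Metric.closedBall 0 R = ∅ := by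
    refine Set.eq_empty_of_forall_notMem fun φ hφ => ?_
    have hdist := dist_circlePoint u l φ
    rw [Set.mem_preimage, mem_closedBall_zero_iff] at hφ
    rw [abs_of_nonneg hl0, dist_eq_norm] at hdist
    linarith [norm_sub_le (circlePoint u l φ) u]
  rw [circleLengthInDisc_eq, hnone, Set.inter_empty, measureReal_empty, mul_zero]

lemma volume_Ioc_inter_preimage_sub {S : Set ℝ} (hS : MeasurableSet S)
    (hper : Function.Periodic (· ∈ S) (2 * Real.pi)) (ψ : ℝ) :
    volume.real (Set.Ioc (-Real.pi) Real.pi ∩ (· - ψ) ⁻¹' S)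
      = volume.real (Set.Ioc (-Real.pi) Real.pi ∩ S) := by
  have hindicator : ∀ T : Set ℝ, MeasurableSet T → volume.real (Set.Ioc (-Real.pi) Real.pi ∩ T)
      = ∫ x in -Real.pi..Real.pi, T.indicator 1 x := fun T hT => by
    rw [intervalIntegral.integral_of_le (by linarith [Real.pi_pos]), integral_indicator_one hT,
      measureReal_restrict_apply hT, Set.inter_comm]
  have hind : Function.Periodic (S.indicator (1 : ℝ → ℝ)) (2 * Real.pi) := fun x => by
    classical
    simp only [Set.indicator_apply, hper x, Pi.one_apply]
  rw [hindicator _ hS, hindicator _ (measurable_sub_const ψ hS)]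
  calc ∫ x in -Real.pi..Real.pi, ((· - ψ) ⁻¹' S).indicator 1 x
      = ∫ x in -Real.pi - ψ..Real.pi - ψ, S.indicator 1 x := by
        rw [← intervalIntegral.integral_comp_sub_right]
        rfl
    _ = ∫ x in -Real.pi..Real.pi, S.indicator 1 x := by
        have hshift := hind.intervalIntegral_add_eq (-Real.pi - ψ) (-Real.pi)
        convert hshift using 2 <;> ring

lemma volume_cos_le {k : ℝ} (hk : -1 ≤ k) :
    volume.real (Set.Ioc (-Real.pi) Real.pi ∩ {x | Real.cos x ≤ k})
      = 2 * Real.pi - 2 * Real.arccos k := by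
  have hiff : ∀ x ∈ Set.Icc 0 Real.pi, Real.cos x ≤ k ↔ Real.arccos k ≤ x := fun x hx => by
    refine ⟨fun h => (Real.antitone_arccos h).trans_eq (Real.arccos_cos hx.1 hx.2), fun h => ?_⟩
    rcases le_total k 1 with hk1 | hk1
    · exact (Real.cos_le_cos_of_nonneg_of_le_pi (Real.arccos_nonneg k) hx.2 h).trans_eq
        (Real.cos_arccos hk hk1)
    · exact (Real.cos_le_one x).trans hk1
  have hpi := Real.arccos_le_pi k
  have hset : Set.Ioc (-Real.pi) Real.pi ∩ {x | Real.cos x ≤ k}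
      = Set.Ioc (-Real.pi) Real.pi \ Set.Ioo (-Real.arccos k) (Real.arccos k) := by
    ext x
    simp only [Set.mem_inter_iff, Set.mem_ofPred_eq, Set.mem_sdiff, Set.mem_Ioo, ← abs_lt, not_lt]
    refine and_congr_right fun hx => ?_
    rw [← Real.cos_abs, hiff |x| ⟨abs_nonneg x, abs_le.2 ⟨hx.1.le, hx.2⟩⟩]
  have hsub : Set.Ioo (-Real.arccos k) (Real.arccos k) ⊆ Set.Ioc (-Real.pi) Real.pi :=
    fun x hx => ⟨by linarith [hx.1], by linarith [hx.2]⟩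
  rw [hset, measureReal_sdiff hsub measurableSet_Ioo (by simp),
    Real.volume_real_Ioc_of_le (by linarith [Real.pi_pos]),
    Real.volume_real_Ioo_of_le (by linarith [Real.arccos_nonneg k])]
  ring

lemma exists_angle (u : Plane) : ∃ ψ : ℝ, u = circlePoint 0 ‖u‖ ψ := by
  have hnorm : ‖(⟨u 0, u 1⟩ : ℂ)‖ = ‖u‖ := by
    rw [EuclideanSpace.norm_eq, Fin.sum_univ_two, Complex.norm_eq_sqrt_sq_add_sq]
    simp only [Real.norm_eq_abs, sq_abs]
  refine ⟨Complex.arg ⟨u 0, u 1⟩, ?_⟩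
  ext i
  fin_cases i
  · simp [circlePoint, ← hnorm]
  · simp [circlePoint, ← hnorm]

lemma norm_circlePoint_sq (s l ψ φ : ℝ) : ‖circlePoint (circlePoint 0 s ψ) l φ‖ ^ 2
    = s ^ 2 + l ^ 2 + 2 * s * l * Real.cos (φ - ψ) := by
  rw [EuclideanSpace.real_norm_sq_eq, Fin.sum_univ_two, Real.cos_sub]
  simp only [circlePoint, zero_add, PiLp.add_apply, PiLp.smul_apply, Matrix.cons_val_zero,
    Matrix.cons_val_one, Matrix.cons_val_fin_one, smul_eq_mul]
  linear_combination l ^ 2 * Real.sin_sq_add_cos_sq φ + s ^ 2 * Real.sin_sq_add_cos_sq ψ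

/-- The cosine of the angle, seen from a point at distance `r` from the centre of the disc of
radius `R`, between the direction away from the centre and a point at distance `l` on the boundary
circle (law of cosines). -/
noncomputable def interCos (R l r : ℝ) : ℝ := (R ^ 2 - r ^ 2 - l ^ 2) / (2 * r * l)

lemma neg_one_lt_interCos {R l r : ℝ} (hr : 0 < r) (hl : 0 < l) (hrR : r ≤ R) (hlR : l < R + r) :
    -1 < interCos R l r := by
  rw [interCos, lt_div_iff₀ (by positivity)]
  nlinarith

lemma interCos_lt_one {R l r : ℝ} (hr : 0 < r) (hrR : r ≤ R) (hl : R - r < l) :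
    interCos R l r < 1 := by
  have hl0 : 0 < l := by linarith
  rw [interCos, div_lt_one (by positivity)]
  nlinarith

lemma circleLengthInDisc_eq_arccos {R l : ℝ} {u : Plane} (hu0 : 0 < ‖u‖) (hl0 : 0 < l)
    (hu : ‖u‖ ≤ R) (hl : l ≤ R + ‖u‖) :
    circleLengthInDisc R l u = (2 * Real.pi - 2 * Real.arccos (interCos R l ‖u‖)) * l := by
  have hge : -1 ≤ interCos R l ‖u‖ := by
    rw [interCos, le_div_iff₀ (by positivity)]
    nlinarith
  obtain ⟨ψ, hψ⟩ := exists_angle u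
  have hset : circlePoint u l ⁻¹' Metric.closedBall 0 R
      = (· - ψ) ⁻¹' {x | Real.cos x ≤ interCos R l ‖u‖} := by
    ext φ
    have hcos := norm_circlePoint_sq ‖u‖ l ψ φ
    rw [← hψ] at hcos
    rw [Set.mem_preimage, mem_closedBall_zero_iff, ← sq_le_sq₀ (norm_nonneg _) (hu0.le.trans hu),
      hcos, Set.mem_preimage, Set.mem_ofPred_eq, interCos, le_div_iff₀ (by positivity)]
    constructor <;> intro h <;> linarith
  rw [circleLengthInDisc_eq, hset, volume_Ioc_inter_preimage_sub
      (measurableSet_le Real.measurable_cos measurable_const)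
      (fun x => by simp only [Set.mem_ofPred_eq, Real.cos_add_two_pi]),
    volume_cos_le hge, mul_comm]

lemma circleLengthInDisc_pos {R l : ℝ} {u : Plane} (hu : ‖u‖ ≤ R) (hl0 : 0 < l)
    (hl : l < R + ‖u‖) : 0 < circleLengthInDisc R l u := by
  rcases le_or_gt l (R - ‖u‖) with hle | hgt
  · rw [circleLengthInDisc_of_le hl0.le hle]
    positivity
  · have hu0 : 0 < ‖u‖ := by linarith
    rw [circleLengthInDisc_eq_arccos hu0 hl0 hu hl.le]
    have harc := Real.arccos_lt_pi.2 (neg_one_lt_interCos hu0 hl0 hu hl)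
    exact mul_pos (by linarith) hl0

lemma m₂_eq_neg (R l r : ℝ) : m₂ R l r = -m₁ R l r := by
  rw [m₂, m₁, x₂, x₁, div_neg]

lemma m₁_eq {R l r : ℝ} (hr : 0 < r) (hl : 0 < l) :
    m₁ R l r = interCos R l r / Real.sqrt (1 - interCos R l r ^ 2) := by
  have hheron : (r + R + l) * (r + R - l) * (r - R + l) * (-r + R + l)
      = (2 * r * l) ^ 2 * (1 - interCos R l r ^ 2) := by
    rw [interCos]
    field_simp
    ring
  have hx : x₁ R l r = l * Real.sqrt (1 - interCos R l r ^ 2) := by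
    rw [x₁, heronArea, hheron, Real.sqrt_mul (sq_nonneg _), Real.sqrt_sq (by positivity)]
    field_simp
    ring
  have hy : yInter R l r - r = l * interCos R l r := by
    rw [yInter, interCos]
    field_simp
    ring
  rw [m₁, hx, hy, mul_div_mul_left _ _ hl.ne']

lemma arcAngle_eq_arccos {R l r : ℝ} (hr : 0 < r) (hrR : r ≤ R) (hl1 : R - r < l)
    (hl2 : l < R + r) : arcAngle R l r = 2 * Real.pi - 2 * Real.arccos (interCos R l r) := by
  have hl0 : 0 < l := by linarith
  rw [arcAngle, if_pos hl2, m₂_eq_neg, Real.arctan_neg, m₁_eq hr hl0, ← Real.arcsin_eq_arctan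
    ⟨neg_one_lt_interCos hr hl0 hrR hl2, interCos_lt_one hr hrR hl1⟩, Real.arccos]
  ring

lemma tan_arcAngle {R l r : ℝ} (hl : l < R + r) :
    Real.tan (arcAngle R l r) = (m₁ R l r - m₂ R l r) / (1 + m₁ R l r * m₂ R l r) := by
  have hdouble : arcAngle R l r = 2 * Real.arctan (m₁ R l r) + Real.pi := by
    rw [arcAngle, if_pos hl, m₂_eq_neg, Real.arctan_neg]
    ring
  rw [hdouble, Real.tan_add_pi, Real.tan_two_mul, Real.tan_arctan, m₂_eq_neg]
  ring

theorem arcC_eq_circleLengthInDisc {R l : ℝ} {u : Plane} (hu : ‖u‖ ≤ R) (hl : R - ‖u‖ < l) :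
    arcC R l ‖u‖ = circleLengthInDisc R l u := by
  rcases lt_trichotomy l (R + ‖u‖) with hlt | heq | hgt
  · have hu0 : 0 < ‖u‖ := by linarith
    rw [circleLengthInDisc_eq_arccos hu0 (by linarith) hu hlt.le, arcC,
      arcAngle_eq_arccos hu0 hu hl hlt]
  · have hu0 : 0 < ‖u‖ := by linarith
    have hl0 : 0 < l := by linarith
    have hcos : interCos R l ‖u‖ ≤ -1 := by
      rw [interCos, div_le_iff₀ (by positivity), heq]
      linarith
    rw [arcC, arcAngle, if_neg heq.not_lt, zero_mul, circleLengthInDisc_eq_arccos hu0 hl0 hu heq.le,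
      Real.arccos_of_le_neg_one hcos, sub_self, zero_mul]
  · rw [arcC, arcAngle, if_neg hgt.not_gt, zero_mul,
      circleLengthInDisc_of_gt (by linarith [norm_nonneg u]) hgt]

end Geometry

section Polar

lemma lintegral_eq_polarCoord (F : Plane → ENNReal) :
    ∫⁻ x, F x = ∫⁻ q in polarCoord.target, ENNReal.ofReal q.1 * F (circlePoint 0 q.1 q.2) := by
  have hfun : ∫⁻ x, F x = ∫⁻ y : Fin 2 → ℝ, F (WithLp.toLp 2 y) :=
    ((PiLp.volume_preserving_toLp (Fin 2)).lintegral_comp_emb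
      (MeasurableEquiv.toLp 2 (Fin 2 → ℝ)).measurableEmbedding F).symm
  have hprod : ∫⁻ y : Fin 2 → ℝ, F (WithLp.toLp 2 y) = ∫⁻ q : ℝ × ℝ, F !₂[q.1, q.2] :=
    ((volume_preserving_finTwoArrow ℝ).symm.lintegral_comp_emb
      (MeasurableEquiv.finTwoArrow (α := ℝ)).symm.measurableEmbedding
      fun y => F (WithLp.toLp 2 y)).symm
  rw [hfun, hprod, ← lintegral_comp_polarCoord_symm]
  refine lintegral_congr fun q => ?_
  rw [smul_eq_mul, polarCoord_symm_apply]
  congr 2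
  ext i
  fin_cases i <;> simp [circlePoint]

lemma lintegral_eq_lintegral_circlePoint (u : Plane) {F : Plane → ENNReal} (hF : Measurable F) :
    ∫⁻ x, F x = ∫⁻ v in Set.Ioi (0 : ℝ), ENNReal.ofReal v *
      ∫⁻ φ in Set.Ioc (-Real.pi) Real.pi, F (circlePoint u v φ) := by
  have hmeas : Measurable fun q : ℝ × ℝ => F (circlePoint u q.1 q.2) :=
    hF.comp (continuous_circlePoint u).measurable
  have hshift : ∀ v φ, u + circlePoint 0 v φ = circlePoint u v φ := fun v φ => by
    rw [circlePoint, circlePoint, zero_add]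
  rw [← lintegral_add_left_eq_self _ u, lintegral_eq_polarCoord, polarCoord_target,
    Measure.volume_eq_prod, ← Measure.prod_restrict, Measure.restrict_congr_set Ioo_ae_eq_Ioc]
  simp_rw [hshift]
  rw [lintegral_prod (fun q : ℝ × ℝ => ENNReal.ofReal q.1 * F (circlePoint u q.1 q.2))
    (measurable_fst.ennreal_ofReal.mul hmeas).aemeasurable]
  refine lintegral_congr fun v => ?_
  have hv : Measurable fun φ => F (circlePoint u v φ) := hmeas.comp measurable_prodMk_left
  rw [← lintegral_const_mul _ hv]

lemma lintegral_disc_dist (R : ℝ) (u : Plane) {q : ℝ → ENNReal} (hq : Measurable q) :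
    ∫⁻ x in Metric.closedBall (0 : Plane) R, q (dist x u)
      = ∫⁻ v in Set.Ioi (0 : ℝ), ENNReal.ofReal (circleLengthInDisc R v u) * q v := by
  have hdist : Measurable fun x : Plane => q (dist x u) :=
    hq.comp (measurable_id.dist measurable_const)
  rw [← lintegral_indicator measurableSet_closedBall,
    lintegral_eq_lintegral_circlePoint u (hdist.indicator measurableSet_closedBall)]
  refine setLIntegral_congr_fun measurableSet_Ioi fun v hv => ?_
  have harc : MeasurableSet (circlePoint u v ⁻¹' Metric.closedBall 0 R) :=
    (Metric.isClosed_closedBall.preimage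
      ((continuous_circlePoint u).comp (Continuous.prodMk_right v))).measurableSet
  have hind : ∀ φ, (Metric.closedBall 0 R).indicator (fun x => q (dist x u)) (circlePoint u v φ)
      = q v * (circlePoint u v ⁻¹' Metric.closedBall 0 R).indicator 1 φ := fun φ => by
    by_cases hφ : circlePoint u v φ ∈ Metric.closedBall 0 R
    · rw [Set.indicator_of_mem hφ, Set.indicator_of_mem (Set.mem_preimage.2 hφ),
        dist_circlePoint, abs_of_pos hv, Pi.one_apply, mul_one]
    · rw [Set.indicator_of_notMem hφ, Set.indicator_of_notMem (mt Set.mem_preimage.1 hφ), mul_zero]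
  simp only [hind]
  rw [lintegral_const_mul _ (measurable_one.indicator harc), lintegral_indicator_one harc,
    Measure.restrict_apply harc, Set.inter_comm, circleLengthInDisc_eq,
    ENNReal.ofReal_mul (le_of_lt hv),
    ofReal_measureReal ((measure_mono Set.inter_subset_left).trans_lt (by simp)).ne,
    mul_assoc, mul_comm (q v)]

lemma map_dist_volume_disc (R : ℝ) (u : Plane) :
    Measure.map (fun x => dist x u) (volume.restrict (Metric.closedBall (0 : Plane) R))
      = (volume.restrict (Set.Ioi 0)).withDensity
          fun v => ENNReal.ofReal (circleLengthInDisc R v u) := by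
  have hdist : Measurable fun x : Plane => dist x u := measurable_id.dist measurable_const
  refine Measure.ext_of_lintegral _ fun q hq => ?_
  rw [lintegral_map hq hdist, lintegral_disc_dist R u hq, lintegral_withDensity_eq_lintegral_mul _
    (measurable_circleLengthInDisc R u).ennreal_ofReal hq]
  rfl

lemma setIntegral_dist_disc (R t : ℝ) (u : Plane) {p : ℝ → ℝ} (hp : Measurable p) :
    ∫ x in Metric.closedBall u t, p (dist x u) ∂(volume.restrict (Metric.closedBall 0 R))
      = ∫ v in Set.Ioc 0 t, circleLengthInDisc R v u * p v := by
  have hdist : Measurable fun x : Plane => dist x u := measurable_id.dist measurable_const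
  have hball : Metric.closedBall u t = (fun x => dist x u) ⁻¹' Set.Iic t := rfl
  rw [hball, ← setIntegral_map measurableSet_Iic hp.aestronglyMeasurable hdist.aemeasurable,
    map_dist_volume_disc, setIntegral_withDensity_eq_setIntegral_toReal_smul
      (measurable_circleLengthInDisc R u).ennreal_ofReal
      (.of_forall fun _ => ENNReal.ofReal_lt_top) _ measurableSet_Iic,
    Measure.restrict_restrict measurableSet_Iic, Set.inter_comm, Set.Ioi_inter_Iic]
  refine setIntegral_congr_fun measurableSet_Ioc fun v hv => ?_
  simp only [ENNReal.toReal_ofReal (circleLengthInDisc_nonneg hv.1.le R u), smul_eq_mul]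

lemma intervalIntegrable_circleLengthInDisc_mul (R : ℝ) (u : Plane) {p : ℝ → ℝ}
    (hp : Measurable p) (hp1 : ∀ v, ‖p v‖ ≤ 1) (a b : ℝ) :
    IntervalIntegrable (fun v => circleLengthInDisc R v u * p v) volume a b := by
  have hbound : IntervalIntegrable (fun v : ℝ => 2 * Real.pi * ‖v‖) volume a b :=
    (continuous_const.mul continuous_norm).intervalIntegrable a b
  refine hbound.mono_fun ((measurable_circleLengthInDisc R u).mul hp).aestronglyMeasurable
    (.of_forall fun v => ?_)
  calc ‖circleLengthInDisc R v u * p v‖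
      ≤ 2 * Real.pi * ‖v‖ * 1 := by
        rw [norm_mul]
        gcongr
        exacts [norm_circleLengthInDisc_le R v u, hp1 v]
    _ ≤ ‖2 * Real.pi * ‖v‖‖ := by
        rw [mul_one]
        exact Real.le_norm_self _

end Polar

section Hazard

lemma absolutelyContinuousOnInterval_comp {f φ : ℝ → ℝ} {a b : ℝ} {s : Set ℝ} {L : NNReal}
    (hφ : LipschitzOnWith L φ s) (hf : AbsolutelyContinuousOnInterval f a b)
    (hs : Set.MapsTo f (Set.uIcc a b) s) :
    AbsolutelyContinuousOnInterval (fun x => φ (f x)) a b := by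
  have hbound := Filter.Tendsto.const_mul (L : ℝ) hf
  rw [mul_zero] at hbound
  refine squeeze_zero' (.of_forall fun E => Finset.sum_nonneg fun _ _ => dist_nonneg) ?_ hbound
  filter_upwards [Filter.mem_inf_of_right (Filter.mem_principal_self _)] with E hE
  rw [Finset.mul_sum]
  exact Finset.sum_le_sum fun i hi =>
    hφ.dist_le_mul _ (hs (hE.1 i hi).1) _ (hs (hE.1 i hi).2)

variable {h : ℝ → ℝ} {a b : ℝ}

lemma absolutelyContinuousOnInterval_exp_neg_integral (hi : IntervalIntegrable h volume a b) :
    AbsolutelyContinuousOnInterval (fun v => Real.exp (-∫ w in a..v, h w)) a b := by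
  have hprim : AbsolutelyContinuousOnInterval (fun v => -∫ w in a..v, h w) a b :=
    (hi.absolutelyContinuousOnInterval_intervalIntegral Set.left_mem_uIcc).fun_neg
  obtain ⟨C, hC⟩ := hprim.exists_bound
  have hmaps : Set.MapsTo (fun v => -∫ w in a..v, h w) (Set.uIcc a b) (Set.Icc (-C) C) :=
    fun v hv => abs_le.1 (hC v hv)
  have hexp : ContDiffOn ℝ 1 Real.exp (Set.Icc (-C) C) := Real.contDiff_exp.contDiffOn
  obtain ⟨L, hL⟩ := hexp.exists_lipschitzOnWith one_ne_zero (convex_Icc _ _) isCompact_Icc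
  exact absolutelyContinuousOnInterval_comp hL hprim hmaps

lemma intervalIntegrable_mul_exp_neg_integral (hi : IntervalIntegrable h volume a b) :
    IntervalIntegrable (fun v => h v * Real.exp (-∫ w in a..v, h w)) volume a b :=
  hi.mul_continuousOn (absolutelyContinuousOnInterval_exp_neg_integral hi).continuousOn

theorem integral_mul_exp_neg_integral (hi : IntervalIntegrable h volume a b) :
    ∫ v in a..b, h v * Real.exp (-∫ w in a..v, h w) = 1 - Real.exp (-∫ w in a..b, h w) := by
  have hderiv : ∀ᵐ v, v ∈ Set.uIoc a b → h v * Real.exp (-∫ w in a..v, h w)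
      = -deriv (fun v => Real.exp (-∫ w in a..v, h w)) v := by
    filter_upwards [hi.ae_hasDerivAt_integral] with v hv hvab
    rw [(hv (Set.uIoc_subset_uIcc hvab) a Set.left_mem_uIcc).fun_neg.exp.deriv]
    ring
  rw [intervalIntegral.integral_congr_ae hderiv, intervalIntegral.integral_neg,
    (absolutelyContinuousOnInterval_exp_neg_integral hi).integral_deriv_eq_sub,
    intervalIntegral.integral_same, neg_zero, Real.exp_zero, neg_sub]

theorem setLIntegral_mul_exp_neg_integral (hab : a ≤ b) (hi : IntervalIntegrable h volume a b)
    (hh : ∀ v ∈ Set.Ioc a b, 0 ≤ h v) :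
    ∫⁻ v in Set.Icc a b, ENNReal.ofReal (h v * Real.exp (-∫ w in a..v, h w))
      = ENNReal.ofReal (1 - Real.exp (-∫ w in a..b, h w)) := by
  have hnonneg : 0 ≤ᵐ[volume.restrict (Set.Ioc a b)]
      fun v => h v * Real.exp (-∫ w in a..v, h w) :=
    (ae_restrict_iff' measurableSet_Ioc).2
      (.of_forall fun v hv => mul_nonneg (hh v hv) (Real.exp_nonneg _))
  rw [← integral_mul_exp_neg_integral hi, intervalIntegral.integral_of_le hab,
    ofReal_integral_eq_lintegral_ofReal (intervalIntegrable_mul_exp_neg_integral hi).1 hnonneg,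
    Measure.restrict_congr_set Ioc_ae_eq_Icc]

end Hazard

section Formulas

/-- The intensity at `v` of the distances from `u` to the marked points, when points of density
`lb` on the disc of radius `R` around the origin are marked with probability `p` of their distance
from `u`. It is the hazard rate of the distance to the nearest marked point, and both cases of `BN`
and `fN` are instances of one formula in it. -/
noncomputable def markedIntensity (lb R : ℝ) (p : ℝ → ℝ) (u : Plane) (v : ℝ) : ℝ :=
  lb * (circleLengthInDisc R v u * p v)

variable {lb R r₀ t : ℝ} {u : Plane} {p : ℝ → ℝ}

lemma markedIntensity_nonneg (hlb : 0 ≤ lb) (hp0 : ∀ v, 0 ≤ p v) {v : ℝ} (hv : 0 ≤ v) :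
    0 ≤ markedIntensity lb R p u v :=
  mul_nonneg hlb (mul_nonneg (circleLengthInDisc_nonneg hv R u) (hp0 v))

lemma intervalIntegrable_markedIntensity (lb R : ℝ) (u : Plane) (hp : Measurable p)
    (hp1 : ∀ v, ‖p v‖ ≤ 1) (a b : ℝ) :
    IntervalIntegrable (markedIntensity lb R p u) volume a b :=
  (intervalIntegrable_circleLengthInDisc_mul R u hp hp1 a b).const_mul lb

lemma setIntegral_closedBall_dist (hlb : 0 ≤ lb) (R : ℝ) (ht : 0 ≤ t) (u : Plane)
    (hp : Measurable p) :
    ∫ x in Metric.closedBall u t, p (dist x u)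
        ∂(ENNReal.ofReal lb • volume.restrict (Metric.closedBall 0 R))
      = ∫ v in 0..t, markedIntensity lb R p u v := by
  rw [Measure.restrict_smul, integral_smul_measure, ENNReal.toReal_ofReal hlb,
    setIntegral_dist_disc R t u hp, intervalIntegral.integral_of_le ht, smul_eq_mul,
    ← integral_const_mul]
  rfl

lemma integral_markedIntensity_of_le (lb : ℝ) (p : ℝ → ℝ) (ht : 0 ≤ t) (htu : t ≤ R - ‖u‖) :
    ∫ v in 0..t, markedIntensity lb R p u v = 2 * Real.pi * lb * ∫ v in 0..t, v * p v := by
  rw [← intervalIntegral.integral_const_mul]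
  refine intervalIntegral.integral_congr fun v hv => ?_
  rw [Set.uIcc_of_le ht] at hv
  simp only [markedIntensity, circleLengthInDisc_of_le hv.1 (hv.2.trans htu)]
  ring

lemma integral_markedIntensity_of_ge (lb : ℝ) (hu : ‖u‖ ≤ R) (hp : Measurable p)
    (hp1 : ∀ v, ‖p v‖ ≤ 1) (htu : R - ‖u‖ ≤ t) :
    ∫ v in 0..t, markedIntensity lb R p u v
      = lb * (2 * Real.pi * (∫ v in 0..(R - ‖u‖), v * p v)
        + ∫ v in (R - ‖u‖)..t, arcC R v ‖u‖ * p v) := by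
  have houter : ∫ v in (R - ‖u‖)..t, markedIntensity lb R p u v
      = lb * ∫ v in (R - ‖u‖)..t, arcC R v ‖u‖ * p v := by
    rw [← intervalIntegral.integral_const_mul]
    refine intervalIntegral.integral_congr_ae (.of_forall fun v hv => ?_)
    rw [Set.uIoc_of_le htu] at hv
    rw [markedIntensity, arcC_eq_circleLengthInDisc hu hv.1]
  rw [← intervalIntegral.integral_add_adjacent_intervals
    (intervalIntegrable_markedIntensity lb R u hp hp1 0 (R - ‖u‖))
    (intervalIntegrable_markedIntensity lb R u hp hp1 (R - ‖u‖) t), houter,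
    integral_markedIntensity_of_le lb p (sub_nonneg.2 hu) le_rfl]
  ring

theorem BN_eq (lb : ℝ) (hu : ‖u‖ ≤ R) (hp : Measurable p) (hp1 : ∀ v, ‖p v‖ ≤ 1)
    (hr₀ : 0 ≤ r₀) :
    BN lb R r₀ p ‖u‖ = 1 - Real.exp (-∫ v in 0..r₀, markedIntensity lb R p u v) := by
  rw [BN]
  split_ifs with hinside
  · rw [integral_markedIntensity_of_le lb p hr₀ (by linarith)]
  · rw [integral_markedIntensity_of_ge lb hu hp hp1 (by linarith)]

theorem fN_eq (lb : ℝ) (hu : ‖u‖ ≤ R) (hp : Measurable p) (hp1 : ∀ v, ‖p v‖ ≤ 1) {l : ℝ}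
    (hl : l ∈ Set.Icc 0 r₀) :
    fN lb R r₀ p l ‖u‖ = markedIntensity lb R p u l
      * Real.exp (-∫ v in 0..l, markedIntensity lb R p u v) / BN lb R r₀ p ‖u‖ := by
  rw [fN, markedIntensity]
  split_ifs with hinside
  · have hlu : l ≤ R - ‖u‖ := hinside.elim (fun hr₀ => by linarith [hl.2]) id
    rw [integral_markedIntensity_of_le lb p hl.1 hlu, circleLengthInDisc_of_le hl.1 hlu]
    ring
  · have hlu : R - ‖u‖ < l := not_le.1 fun hlu => hinside (.inr hlu)
    rw [integral_markedIntensity_of_ge lb hu hp hp1 hlu.le, arcC_eq_circleLengthInDisc hu hlu]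
    ring

lemma integral_markedIntensity_pos (hlb : 0 < lb) (hu : ‖u‖ ≤ R) (hp : Measurable p)
    (hp01 : ∀ v, p v ∈ Set.Icc (0 : ℝ) 1)
    (hsupp : 0 < volume (Function.support p ∩ Set.Ioo 0 (min r₀ (R + ‖u‖)))) :
    0 < ∫ v in 0..r₀, markedIntensity lb R p u v := by
  have hr₀ : 0 < r₀ := by
    obtain ⟨v, -, hv⟩ := nonempty_of_measure_ne_zero hsupp.ne'
    exact hv.1.trans (hv.2.trans_le (min_le_left _ _))
  have hnonneg : 0 ≤ᵐ[volume.restrict (Set.Ioc 0 r₀)] markedIntensity lb R p u :=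
    (ae_restrict_iff' measurableSet_Ioc).2
      (.of_forall fun v hv => markedIntensity_nonneg hlb.le (fun v => (hp01 v).1) hv.1.le)
  have hintegrable := intervalIntegrable_markedIntensity lb R u hp
    (fun v => (Real.norm_of_nonneg (hp01 v).1).trans_le (hp01 v).2) 0 r₀
  rw [intervalIntegral.integral_of_le hr₀.le,
    setIntegral_pos_iff_support_of_nonneg_ae hnonneg hintegrable.1]
  refine hsupp.trans_le (measure_mono fun v ⟨hpv, hv0, hv⟩ => ⟨?_, hv0, ?_⟩)
  · exact mul_ne_zero hlb.ne' (mul_ne_zero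
      (circleLengthInDisc_pos hu hv0 (hv.trans_le (min_le_right _ _))).ne' hpv)
  · exact hv.le.trans (min_le_left _ _)

end Formulas

section Nearest

variable {Ω : Type*} {K : Ω → ℕ} {X : ℕ → Ω → Plane} {Z : ℕ → Set Ω} {u : Plane}

lemma markedInRange_eq_markedIn (K : Ω → ℕ) (X : ℕ → Ω → Plane) (Z : ℕ → Set Ω) (u : Plane)
    (t : ℝ) : markedInRange K X Z u t = markedIn K X Z (Metric.closedBall u t) :=
  rfl

lemma markedInRange_mono {s t : ℝ} (hst : s ≤ t) :
    markedInRange K X Z u s ⊆ markedInRange K X Z u t :=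
  fun _ ⟨i, hi, hz, hd⟩ => ⟨i, hi, hz, hd.trans hst⟩

lemma markedInRange_of_neg {t : ℝ} (ht : t < 0) : markedInRange K X Z u t = ∅ :=
  Set.eq_empty_of_forall_notMem fun _ ⟨_, _, _, hd⟩ => (dist_nonneg.trans hd).not_gt ht

lemma nearestMarkedDist_le_iff {ω : Ω} (hω : ω ∈ markedIn K X Z Set.univ) (t : ℝ) :
    nearestMarkedDist K X Z u ω ≤ t ↔ ω ∈ markedInRange K X Z u t := by
  have hfin : {d : ℝ | ∃ i, i < K ω ∧ ω ∈ Z i ∧ d = dist (X i ω) u}.Finite := by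
    refine ((Set.finite_Iio (K ω)).image fun i => dist (X i ω) u).subset ?_
    rintro d ⟨i, hi, -, rfl⟩
    exact ⟨i, hi, rfl⟩
  have hne : {d : ℝ | ∃ i, i < K ω ∧ ω ∈ Z i ∧ d = dist (X i ω) u}.Nonempty :=
    let ⟨i, hi, hz, _⟩ := hω
    ⟨_, i, hi, hz, rfl⟩
  constructor
  · intro hle
    obtain ⟨i, hi, hz, hd⟩ := hne.csInf_mem hfin
    exact ⟨i, hi, hz, hd ▸ hle⟩
  · rintro ⟨i, hi, hz, hd⟩
    exact (csInf_le hfin.bddBelow ⟨i, hi, hz, rfl⟩).trans hd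

lemma nearestMarkedDist_of_notMem {ω : Ω} (hω : ω ∉ markedIn K X Z Set.univ) :
    nearestMarkedDist K X Z u ω = 0 := by
  have hempty : {d : ℝ | ∃ i, i < K ω ∧ ω ∈ Z i ∧ d = dist (X i ω) u} = ∅ :=
    Set.eq_empty_of_forall_notMem fun _ ⟨i, hi, hz, _⟩ => hω ⟨i, hi, hz, Set.mem_univ _⟩
  rw [nearestMarkedDist, hempty, Real.sInf_empty]

lemma markedInRange_subset_markedIn_univ (K : Ω → ℕ) (X : ℕ → Ω → Plane) (Z : ℕ → Set Ω)
    (u : Plane) (t : ℝ) : markedInRange K X Z u t ⊆ markedIn K X Z Set.univ :=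
  fun _ ⟨i, hi, hz, _⟩ => ⟨i, hi, hz, Set.mem_univ _⟩

lemma markedInRange_inter_preimage_Iic (K : Ω → ℕ) (X : ℕ → Ω → Plane) (Z : ℕ → Set Ω)
    (u : Plane) (r₀ t : ℝ) :
    markedInRange K X Z u r₀ ∩ nearestMarkedDist K X Z u ⁻¹' Set.Iic t
      = markedInRange K X Z u (min t r₀) := by
  ext ω
  constructor
  · rintro ⟨hr₀, ht⟩
    have hω := markedInRange_subset_markedIn_univ K X Z u r₀ hr₀
    rw [← nearestMarkedDist_le_iff hω] at hr₀ ⊢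
    exact le_min ht hr₀
  · intro hmin
    have hω := markedInRange_subset_markedIn_univ K X Z u _ hmin
    exact ⟨markedInRange_mono (min_le_right _ _) hmin,
      (nearestMarkedDist_le_iff hω t).2 (markedInRange_mono (min_le_left _ _) hmin)⟩

variable [MeasurableSpace Ω]

lemma measurable_nearestMarkedDist (hK : Measurable K) (hX : ∀ i, Measurable (X i))
    (hZ : ∀ i, MeasurableSet (Z i)) : Measurable (nearestMarkedDist K X Z u) := by
  refine measurable_of_Iic fun t => ?_
  have hset : nearestMarkedDist K X Z u ⁻¹' Set.Iic t
      = markedInRange K X Z u t ∪ ((markedIn K X Z Set.univ)ᶜ ∩ {_ω | 0 ≤ t}) := by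
    ext ω
    by_cases hω : ω ∈ markedIn K X Z Set.univ
    · simp only [Set.mem_preimage, Set.mem_Iic, nearestMarkedDist_le_iff hω, Set.mem_union,
        Set.mem_inter_iff, Set.mem_compl_iff, hω, not_true_eq_false, false_and, or_false]
    · have hωt := mt (@markedInRange_subset_markedIn_univ Ω K X Z u t ω) hω
      simp only [Set.mem_preimage, Set.mem_Iic, nearestMarkedDist_of_notMem hω, Set.mem_union,
        Set.mem_inter_iff, Set.mem_compl_iff, hω, hωt, not_false_eq_true, true_and, false_or,
        Set.mem_ofPred_eq]
  rw [hset]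
  exact (measurableSet_markedIn hK hX hZ measurableSet_closedBall).union
    ((measurableSet_markedIn hK hX hZ .univ).compl.inter (.const _))

variable {P : Measure Ω} [IsProbabilityMeasure P] {lb R r₀ : ℝ} {p : ℝ → ℝ}

theorem measure_markedInRange (hlb : 0 ≤ lb)
    (hX : IsPoissonPointProcess K X
      (ENNReal.ofReal lb • volume.restrict (Metric.closedBall 0 R)) P)
    (hZ : IsIndependentMarking K X Z (fun x => p (dist x u)) P)
    (hp : Measurable p) (hp01 : ∀ v, p v ∈ Set.Icc (0 : ℝ) 1) {t : ℝ} (ht : 0 ≤ t) :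
    P (markedInRange K X Z u t)
      = ENNReal.ofReal (1 - Real.exp (-∫ v in 0..t, markedIntensity lb R p u v)) := by
  have : IsFiniteMeasure (volume.restrict (Metric.closedBall (0 : Plane) R)) :=
    isFiniteMeasure_restrict.2 measure_closedBall_lt_top.ne
  have := Measure.smul_finite (volume.restrict (Metric.closedBall (0 : Plane) R))
    (ENNReal.ofReal_ne_top (r := lb))
  have hmeas := measurableSet_markedIn hX.measurable_num hX.measurable_point
    hZ.measurableSet_mark (measurableSet_closedBall (x := u) (ε := t))
  have hpdist : Measurable fun x : Plane => p (dist x u) :=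
    hp.comp (measurable_id.dist measurable_const)
  rw [← setIntegral_closedBall_dist hlb R ht u hp, ← hX.measureReal_markedIn_compl hZ hpdist
    (fun x => hp01 _) measurableSet_closedBall, ← probReal_compl_eq_one_sub hmeas.compl,
    compl_compl, ofReal_measureReal, markedInRange_eq_markedIn]

lemma setLIntegral_fN (hlb : 0 ≤ lb) (hu : ‖u‖ ≤ R) (hp : Measurable p)
    (hp01 : ∀ v, p v ∈ Set.Icc (0 : ℝ) 1) (hpos : 0 < BN lb R r₀ p ‖u‖) {t : ℝ} (ht : 0 ≤ t)
    (htr₀ : t ≤ r₀) :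
    ∫⁻ l in Set.Icc 0 t, ENNReal.ofReal (fN lb R r₀ p l ‖u‖)
      = (ENNReal.ofReal (BN lb R r₀ p ‖u‖))⁻¹
        * ENNReal.ofReal (1 - Real.exp (-∫ v in 0..t, markedIntensity lb R p u v)) := by
  have hp1 : ∀ v, ‖p v‖ ≤ 1 := fun v => (Real.norm_of_nonneg (hp01 v).1).trans_le (hp01 v).2
  rw [← setLIntegral_mul_exp_neg_integral ht (intervalIntegrable_markedIntensity lb R u hp hp1 0 t)
      fun v hv => markedIntensity_nonneg hlb (fun v => (hp01 v).1) hv.1.le,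
    ← ENNReal.ofReal_inv_of_pos hpos, ← lintegral_const_mul' _ _ ENNReal.ofReal_ne_top]
  refine setLIntegral_congr_fun measurableSet_Icc fun l hl => ?_
  rw [fN_eq lb hu hp hp1 ⟨hl.1, hl.2.trans htr₀⟩, ← ENNReal.ofReal_mul (inv_nonneg.2 hpos.le),
    div_eq_inv_mul]

theorem map_nearestMarkedDist_cond (hlb : 0 ≤ lb) (hu : ‖u‖ ≤ R)
    (hX : IsPoissonPointProcess K X
      (ENNReal.ofReal lb • volume.restrict (Metric.closedBall 0 R)) P)
    (hZ : IsIndependentMarking K X Z (fun x => p (dist x u)) P)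
    (hp : Measurable p) (hp01 : ∀ v, p v ∈ Set.Icc (0 : ℝ) 1) (hr₀ : 0 ≤ r₀)
    (hpos : 0 < BN lb R r₀ p ‖u‖) :
    Measure.map (nearestMarkedDist K X Z u) (cond P (markedInRange K X Z u r₀))
      = (volume.restrict (Set.Icc 0 r₀)).withDensity
        fun l => ENNReal.ofReal (fN lb R r₀ p l ‖u‖) := by
  have hdist := measurable_nearestMarkedDist (u := u) hX.measurable_num hX.measurable_point
    hZ.measurableSet_mark
  have hmarked : MeasurableSet (markedInRange K X Z u r₀) :=
    measurableSet_markedIn hX.measurable_num hX.measurable_point hZ.measurableSet_mark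
      measurableSet_closedBall
  have hfin := Measure.isFiniteMeasure_map (cond P (markedInRange K X Z u r₀))
    (nearestMarkedDist K X Z u)
  have hinter : ∀ t, Set.Iic t ∩ Set.Icc 0 r₀ = Set.Icc 0 (min t r₀) := fun t => by
    ext x
    simp only [Set.mem_inter_iff, Set.mem_Iic, Set.mem_Icc, le_min_iff]
    tauto
  refine Measure.ext_of_Iic _ _ fun t => ?_
  rw [Measure.map_apply hdist measurableSet_Iic, cond_apply hmarked,
    markedInRange_inter_preimage_Iic, withDensity_apply _ measurableSet_Iic,
    Measure.restrict_restrict measurableSet_Iic, hinter]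
  rcases lt_or_ge t 0 with ht | ht
  · have hmin : min t r₀ < 0 := (min_le_left _ _).trans_lt ht
    rw [markedInRange_of_neg hmin, Set.Icc_eq_empty hmin.not_ge, measure_empty, mul_zero,
      Measure.restrict_empty, lintegral_zero_measure]
  · have hmin : 0 ≤ min t r₀ := le_min ht hr₀
    rw [setLIntegral_fN hlb hu hp hp01 hpos hmin (min_le_right _ _),
      BN_eq lb hu hp (fun v => (Real.norm_of_nonneg (hp01 v).1).trans_le (hp01 v).2) hr₀,
      ← measure_markedInRange hlb hX hZ hp hp01 hmin,
      ← measure_markedInRange hlb hX hZ hp hp01 hr₀]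

end Nearest

section Blockage

lemma pB_mem_Icc {lam rB : ℝ} (hlam : 0 ≤ lam) (hrB : 0 ≤ rB) (l : ℝ) :
    pB lam rB l ∈ Set.Icc (0 : ℝ) 1 := by
  have hexponent : 0 ≤ lam * max (l - rB) 0 * rB := by positivity
  rw [pB, neg_mul, neg_mul]
  exact Set.Icc.one_sub_mem ⟨Real.exp_nonneg _, Real.exp_le_one_iff.2 (neg_nonpos.2 hexponent)⟩

lemma pB_pos {lam rB l : ℝ} (hlam : 0 < lam) (hrB : 0 < rB) (hl : rB < l) : 0 < pB lam rB l := by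
  have hexponent : 0 < lam * max (l - rB) 0 * rB :=
    mul_pos (mul_pos hlam (lt_max_of_lt_left (sub_pos.2 hl))) hrB
  rw [pB, sub_pos, Real.exp_lt_one_iff, neg_mul, neg_mul]
  exact neg_neg_of_pos hexponent

lemma measurable_pB (lam rB : ℝ) : Measurable (pB lam rB) := by
  unfold pB
  fun_prop

lemma volume_support_pB_inter_Ioo_pos {lam rB b : ℝ} (hlam : 0 < lam) (hrB : 0 < rB)
    (hb : rB < b) : 0 < volume (Function.support (pB lam rB) ∩ Set.Ioo 0 b) := by
  refine (Real.volume_Ioo.symm ▸ ENNReal.ofReal_pos.2 (sub_pos.2 hb)).trans_le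
    (measure_mono (s := Set.Ioo rB b) fun l hl => ?_)
  exact ⟨(pB_pos hlam hrB hl.1).ne', hrB.trans hl.1, hl.2⟩

end Blockage

end MmWave

theorem proposition2_general
    {Ω : Type*} [MeasurableSpace Ω] (P : MeasureTheory.Measure Ω)
    [MeasureTheory.IsProbabilityMeasure P]
    (lb r₀ R r : ℝ) (hlb : 0 < lb) (hrR : r ≤ R)
    (p : ℝ → ℝ) (hp : Measurable p) (hp01 : ∀ v, p v ∈ Set.Icc (0 : ℝ) 1)
    (hsupp : 0 < MeasureTheory.volume (Function.support p ∩ Set.Ioo 0 (min r₀ (R + r))))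
    (u : MmWave.Plane) (hu : ‖u‖ = r)
    (K : Ω → ℕ) (X : ℕ → Ω → MmWave.Plane)
    (hX : MmWave.IsPoissonPointProcess K X
      (ENNReal.ofReal lb • MeasureTheory.volume.restrict (Metric.closedBall 0 R)) P)
    (Z : ℕ → Set Ω) (hZ : MmWave.IsIndependentMarking K X Z (fun x => p (dist x u)) P) :
    0 < MmWave.BN lb R r₀ p r ∧
    P (MmWave.markedInRange K X Z u r₀) = ENNReal.ofReal (MmWave.BN lb R r₀ p r) ∧
    (∀ l ∈ Set.Icc 0 r₀, 0 ≤ MmWave.fN lb R r₀ p l r) ∧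
    MeasureTheory.Measure.map (MmWave.nearestMarkedDist K X Z u)
        (ProbabilityTheory.cond P (MmWave.markedInRange K X Z u r₀)) =
      (MeasureTheory.volume.restrict (Set.Icc 0 r₀)).withDensity
        (fun l => ENNReal.ofReal (MmWave.fN lb R r₀ p l r)) ∧
    (∀ l, R - r < l → MmWave.arcC R l r = MmWave.circleLengthInDisc R l u) ∧
    (∀ l, R - r < l → l < R + r → 1 + MmWave.m₁ R l r * MmWave.m₂ R l r ≠ 0 →
      Real.tan (MmWave.arcAngle R l r) =
        (MmWave.m₁ R l r - MmWave.m₂ R l r) / (1 + MmWave.m₁ R l r * MmWave.m₂ R l r)) := by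
  subst hu
  have hp1 : ∀ v, ‖p v‖ ≤ 1 := fun v => (Real.norm_of_nonneg (hp01 v).1).trans_le (hp01 v).2
  have hr₀ : 0 ≤ r₀ := by
    obtain ⟨v, -, hv⟩ := MeasureTheory.nonempty_of_measure_ne_zero hsupp.ne'
    exact (hv.1.trans (lt_min_iff.1 hv.2).1).le
  have hBN := MmWave.BN_eq lb hrR hp hp1 hr₀
  have hpos : 0 < MmWave.BN lb R r₀ p ‖u‖ := by
    rw [hBN, sub_pos, Real.exp_lt_one_iff, neg_lt_zero]
    exact MmWave.integral_markedIntensity_pos hlb hrR hp hp01 hsupp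
  refine ⟨hpos, ?_, fun l hl => ?_, ?_, ?_, ?_⟩
  · rw [hBN, MmWave.measure_markedInRange hlb.le hX hZ hp hp01 hr₀]
  · rw [MmWave.fN_eq lb hrR hp hp1 hl]
    exact div_nonneg (mul_nonneg (MmWave.markedIntensity_nonneg hlb.le (fun v => (hp01 v).1) hl.1)
      (Real.exp_nonneg _)) hpos.le
  · exact MmWave.map_nearestMarkedDist_cond hlb.le hrR hX hZ hp hp01 hr₀ hpos
  · exact fun l hl => MmWave.arcC_eq_circleLengthInDisc hrR hl
  · exact fun l _ hl _ => MmWave.tan_arcAngle hl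

theorem proposition2
    {Ω : Type*} [MeasurableSpace Ω] (P : MeasureTheory.Measure Ω)
    [MeasureTheory.IsProbabilityMeasure P]
    (lb lu le rB r₀ R r : ℝ)
    (hlb : 0 < lb) (hlu : 0 ≤ lu) (hle : 0 ≤ le)
    (hrB : 0 < rB) (hrBr₀ : rB < r₀) (hrBR : rB < R) (hrR : r ≤ R)
    -- the user, at distance `r` from the origin
    (u : MmWave.Plane) (hu : ‖u‖ = r)
    -- the base stations `X i`, `i < K`: a Poisson process of density `lb` on the disc
    (K : Ω → ℕ) (X : ℕ → Ω → MmWave.Plane)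
    (hX : MmWave.IsPoissonPointProcess K X
      (ENNReal.ofReal lb • MeasureTheory.volume.restrict (Metric.closedBall 0 R)) P)
    -- `Z i` is the event that the link to the `i`-th base station is NLOS
    (Z : ℕ → Set Ω)
    (hZ : MmWave.IsIndependentMarking K X Z
      (fun x => MmWave.pB (lb + lu + le) rB (dist x u)) P) :
    -- `B_N` is the probability of at least one NLOS base station within range
    0 < MmWave.BN lb R r₀ (MmWave.pB (lb + lu + le) rB) r ∧
    P (MmWave.markedInRange K X Z u r₀) =
      ENNReal.ofReal (MmWave.BN lb R r₀ (MmWave.pB (lb + lu + le) rB) r) ∧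
    -- given that event, the distance to the nearest NLOS base station has density `f_N`
    (∀ l ∈ Set.Icc 0 r₀, 0 ≤ MmWave.fN lb R r₀ (MmWave.pB (lb + lu + le) rB) l r) ∧
    MeasureTheory.Measure.map (MmWave.nearestMarkedDist K X Z u)
        (ProbabilityTheory.cond P (MmWave.markedInRange K X Z u r₀)) =
      (MeasureTheory.volume.restrict (Set.Icc 0 r₀)).withDensity
        (fun l => ENNReal.ofReal (MmWave.fN lb R r₀ (MmWave.pB (lb + lu + le) rB) l r)) ∧
    -- `C(l, r)` is the length of the part of the circle of radius `l` that lies in the disc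
    (∀ l, R - r < l → MmWave.arcC R l r = MmWave.circleLengthInDisc R l u) ∧
    (∀ l, R - r < l → l < R + r → 1 + MmWave.m₁ R l r * MmWave.m₂ R l r ≠ 0 →
      Real.tan (MmWave.arcAngle R l r) =
        (MmWave.m₁ R l r - MmWave.m₂ R l r) / (1 + MmWave.m₁ R l r * MmWave.m₂ R l r)) := by
  have hlam : 0 < lb + lu + le := by linarith
  exact proposition2_general P lb r₀ R r hlb hrR _ (MmWave.measurable_pB _ _)
    (MmWave.pB_mem_Icc hlam.le hrB.le) (MmWave.volume_support_pB_inter_Ioo_pos hlam hrB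
      (lt_min hrBr₀ (by linarith [hu ▸ norm_nonneg u]))) u hu K X hX Z hZ
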